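/- All topological groups are Hausdorff; groups need not be Abelian unless stated. For a topological group $X=(X,\tau)$ let $X^+=(X,\tau^+)$, where $\tau^+$ is the topology induced on $X$ by its Bohr compactification $bX$, i.e. the initial topology with respect to all continuous homomorphisms from $X$ into compact Hausdorff groups. The group $X$ is MAP (maximally almost periodic) if $X^+$ is Hausdorff, and a MAP group $X$ respects compactness if $X$ and $X^+$ have the same compact subsets. Let $k(\tau)$ be the finest group topology on $X$ that coincides with $\tau$ on every $\tau$-compact set; $k(X)=(X,k(\tau))$ is the $k$-modification of $X$, and $X$ is a $k$-group if $k(\tau)=\tau$. Denote by $\mathbf{PCom}$ the class of precompact groups, by $\mathfrak{RC}$ the class of MAP groups respecting compactness, by $\mathbf{LCA}$ the class of locally compact Abelian groups, by $\mathbf{K}$ the class of $k$-groups, by $\mathbf{KA}$ the class of Abelian $k$-groups and by $\mathbf{MAP}$ the class of MAP groups. **Proposition.** Let $X$ and $Y$ be MAP groups. 1. $X\in\mathfrak{RC}$ if and only if $k(X^+)=k(X)$. 2. $X\in\mathbf{K}\cap\mathfrak{RC}$ if and only if $k(X^+)=X$. 3. $\mathbf{PCom}\subsetneq\mathfrak{RC}$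 and $\mathbf{LCA}\subsetneq\mathbf{KA}\cap\mathfrak{RC}$. 4. $\mathbf{K}\cap\mathfrak{RC}\subsetneq\mathbf{K}$ (and even $\mathbf{K}\cap\mathfrak{RC}\subsetneq\mathbf{K}\cap\mathbf{MAP}$), and $\mathbf{K}\cap\mathfrak{RC}\subsetneq\mathfrak{RC}$. 5. If $X\in\mathbf{K}$, $Y\in\mathfrak{RC}$ and $\phi:X\to Y$ is a homomorphism that is continuous as a map $X^+\to Y^+$, then $\phi:X\to Y$ is continuous. -/

import Mathlib

open Topology

universe u v

namespace BohrRespect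

section Bohr

variable (G : Type u) [Group G]

/-- The Bohr topology `t⁺` of a topological group `(G, t)`: the initial topology with respect to
all continuous homomorphisms from `(G, t)` to compact Hausdorff groups. It is the topology induced
by the Bohr compactification, see `bohrTopology_eq_induced`; restricting to compact groups in the
universe of `G` is harmless, see `continuous_bohrTopology`. -/
@[reducible]
def bohrTopology (t : TopologicalSpace G) : TopologicalSpace G :=
  ⨅ (C : Type u) (_ : Group C) (c : TopologicalSpace C) (_ : IsTopologicalGroup C)
    (_ : CompactSpace C) (_ : T2Space C) (f : G →* C) (_ : Continuous[t, c] f),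
    TopologicalSpace.induced f c

/-- The `k`-modification `k(t)` of a group topology `t` on `G`: the finest group topology on `G`
which coincides with `t` on all `t`-compact sets (in Mathlib's order, finest means least). -/
@[reducible]
def kTopology (t : TopologicalSpace G) : TopologicalSpace G :=
  (sInf {s : GroupTopology G | ∀ K : Set G, @IsCompact G t K →
    TopologicalSpace.induced (Subtype.val : K → G) s.toTopologicalSpace =
      TopologicalSpace.induced (Subtype.val : K → G) t}).toTopologicalSpace

variable [t : TopologicalSpace G]

/-- A topological group is maximally almost periodic if its Bohr topology is Hausdorff. -/
def IsMAP : Prop := @T2Space G (bohrTopology G t)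

/-- `G` respects compactness: `G` and `G⁺` have the same compact subsets. -/
def RespectsCompactness : Prop :=
  ∀ K : Set G, IsCompact K ↔ @IsCompact G (bohrTopology G t) K

/-- `G` is a `k`-group: its topology equals its `k`-modification. -/
def IsKGroup : Prop := kTopology G t = t

/-- `G` is precompact: it is covered by finitely many left translates, and by finitely many right
translates, of every neighbourhood of the identity. -/
def IsPrecompactGroup : Prop :=
  ∀ U ∈ 𝓝 (1 : G), ∃ F : Set G, F.Finite ∧
    (∀ x : G, ∃ a ∈ F, ∃ b ∈ U, x = a * b) ∧ (∀ x : G, ∃ a ∈ F, ∃ b ∈ U, x = b * a)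

/-- `(B, i)` is a Bohr compactification of `G`. -/
structure IsBohrCompactification (B : Type u) [Group B] [TopologicalSpace B]
    (i : G →* B) : Prop where
  isTopologicalGroup : IsTopologicalGroup B
  compactSpace : CompactSpace B
  t2Space : T2Space B
  continuous : Continuous i
  denseRange : DenseRange i
  exists_lift : ∀ (C : Type u) [Group C] [TopologicalSpace C] [IsTopologicalGroup C]
    [CompactSpace C] [T2Space C] (p : G →* C), Continuous p →
      ∃ j : B →* C, Continuous j ∧ p = j.comp i

end Bohr

/-- The class `TG` of all Hausdorff topological groups. -/
structure TG where
  carrier : Type u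
  [group : Group carrier]
  [topologicalSpace : TopologicalSpace carrier]
  [isTopologicalGroup : IsTopologicalGroup carrier]
  [t2Space : T2Space carrier]

namespace TG

instance : CoeSort TG.{u} (Type u) := ⟨TG.carrier⟩

attribute [instance] group topologicalSpace isTopologicalGroup t2Space

end TG

/-- MAP groups. -/
def MAP : Set TG.{u} := {X | IsMAP X}

/-- MAP groups respecting compactness. -/
def RC : Set TG.{u} := {X | IsMAP X ∧ RespectsCompactness X}

/-- `k`-groups. -/
def KGrp : Set TG.{u} := {X | IsKGroup X}

/-- Abelian `k`-groups. -/
def KA : Set TG.{u} := {X | IsKGroup X ∧ ∀ x y : X, x * y = y * x}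

/-- Precompact groups. -/
def PCom : Set TG.{u} := {X | IsPrecompactGroup X}

/-- Locally compact Abelian groups. -/
def LCA : Set TG.{u} := {X | LocallyCompactSpace X ∧ ∀ x y : X, x * y = y * x}

section Facts

/-- `k(t)` is indeed a group topology that coincides with `t` on `t`-compact sets, and it is the
finest one. -/
theorem kTopology_spec (G : Type u) [Group G] (t : TopologicalSpace G)
    (ht : @IsTopologicalGroup G t _) :
    @IsTopologicalGroup G (kTopology G t) _ ∧
    (∀ K : Set G, @IsCompact G t K →
      TopologicalSpace.induced (Subtype.val : K → G) (kTopology G t) =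
        TopologicalSpace.induced (Subtype.val : K → G) t) ∧
    ∀ s : TopologicalSpace G, @IsTopologicalGroup G s _ →
      (∀ K : Set G, @IsCompact G t K →
        TopologicalSpace.induced (Subtype.val : K → G) s =
          TopologicalSpace.induced (Subtype.val : K → G) t) → kTopology G t ≤ s := by
  refine ⟨GroupTopology.toIsTopologicalGroup _, fun K hK => ?_, fun s hs h => ?_⟩
  · apply le_antisymm
    · refine induced_mono (sInf_le ?_)
      exact ⟨⟨t, ht⟩, fun _ _ => rfl, rfl⟩
    · rw [kTopology, GroupTopology.toTopologicalSpace_sInf, sInf_image, induced_iInf]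
      refine le_iInf fun s => ?_
      rw [induced_iInf]
      exact le_iInf fun hs => (hs K hK).ge
  · exact sInf_le (a := s) ⟨⟨s, hs⟩, h, rfl⟩

/-- A compact Hausdorff space is no larger than the set of ultrafilters of a dense image. -/
theorem small_of_denseRange {G : Type u} {K : Type v} [TopologicalSpace K] [CompactSpace K]
    [T2Space K] (f : G → K) (hf : DenseRange f) : Small.{u} K := by
  have hc : ∀ F : Ultrafilter G, ∃ x : K, ((F.map f : Ultrafilter K) : Filter K) ≤ 𝓝 x := by
    intro F
    obtain ⟨x, -, hx⟩ := isCompact_univ.ultrafilter_le_nhds (F.map f) (by simp)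
    exact ⟨x, hx⟩
  choose L hL using hc
  have hs : Function.Surjective L := by
    intro x
    have hne : (Filter.comap f (𝓝 x)).NeBot := by
      rw [Filter.comap_neBot_iff]
      intro t ht
      obtain ⟨y, hy, ⟨a, rfl⟩⟩ := mem_closure_iff_nhds.1 (hf x) t ht
      exact ⟨a, hy⟩
    refine ⟨Ultrafilter.of (Filter.comap f (𝓝 x)), ?_⟩
    have h2 : (((Ultrafilter.of (Filter.comap f (𝓝 x))).map f : Ultrafilter K) : Filter K)
        ≤ 𝓝 x := by
      rw [Ultrafilter.coe_map]
      exact Filter.map_le_iff_le_comap.2 (Ultrafilter.of_le _)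
    exact tendsto_nhds_unique (Filter.tendsto_id'.2 (hL _)) (Filter.tendsto_id'.2 h2)
  exact small_of_surjective hs

/-- A compact Hausdorff group, in any universe, with a homomorphism of dense range from `G` has a
copy in the universe of `G`. -/
theorem exists_model {G : Type u} [Group G] {C : Type v} [Group C] [TopologicalSpace C]
    [IsTopologicalGroup C] [CompactSpace C] [T2Space C] (f : G →* C) (hf : DenseRange f) :
    ∃ (D : Type u) (_ : Group D) (_ : TopologicalSpace D) (_ : IsTopologicalGroup D)
      (_ : CompactSpace D) (_ : T2Space D) (e : D ≃* C), Continuous e ∧ Continuous e.symm := by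
  have hsm : Small.{u} C := small_of_denseRange f hf
  let e := (equivShrink.{u} C).symm
  let _ : Group (Shrink.{u} C) := e.group
  let _ : TopologicalSpace (Shrink.{u} C) := TopologicalSpace.induced e inferInstance
  let m : Shrink.{u} C ≃* C := e.mulEquiv
  let h : Shrink.{u} C ≃ₜ C := e.toHomeomorphOfIsInducing ⟨rfl⟩
  have h1 : IsTopologicalGroup (Shrink.{u} C) := topologicalGroup_induced m
  have h2 : CompactSpace (Shrink.{u} C) := h.symm.compactSpace
  have h3 : T2Space (Shrink.{u} C) := h.symm.t2Space
  exact ⟨_, _, _, h1, h2, h3, m, h.continuous, h.symm.continuous⟩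

/-- Every continuous homomorphism to a compact Hausdorff group, in whatever universe, is
continuous for the Bohr topology. -/
theorem continuous_bohrTopology {G : Type u} [Group G] (t : TopologicalSpace G) {C : Type v}
    [Group C] [TopologicalSpace C] [IsTopologicalGroup C] [CompactSpace C] [T2Space C]
    (f : G →* C) (hf : Continuous f) : Continuous[bohrTopology G t, _] f := by
  let S : Subgroup C := f.range.topologicalClosure
  have hS : ∀ x, f x ∈ S := fun x => f.range.le_topologicalClosure ⟨x, rfl⟩
  let g : G →* S := f.codRestrict S hS
  have hSc : IsClosed (S : Set C) := f.range.isClosed_topologicalClosure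
  have : CompactSpace S := isCompact_iff_compactSpace.1 hSc.isCompact
  have hg : Continuous g := hf.subtype_mk _
  have hd : DenseRange g := by
    intro x
    rw [closure_subtype]
    have : (Subtype.val '' Set.range g : Set C) = f.range := by
      rw [← Set.range_comp]
      rfl
    rw [this]
    exact x.2
  obtain ⟨D, gD, tD, h1, h2, h3, e, he, he'⟩ := exists_model g hd
  have hc : Continuous[bohrTopology G t, _] (e.symm.toMonoidHom.comp g) := by
    refine continuous_iff_le_induced.2 ?_
    exact iInf_le_of_le D <| iInf_le_of_le gD <| iInf_le_of_le tD <| iInf_le_of_le h1 <|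
      iInf_le_of_le h2 <| iInf_le_of_le h3 <| iInf_le_of_le (e.symm.toMonoidHom.comp g) <|
      iInf_le _ (he'.comp hg)
  have heq : (f : G → C) = fun x => ((e ((e.symm.toMonoidHom.comp g) x) : S) : C) := by
    ext x
    simp [g]
  rw [heq]
  have hv : Continuous fun d : D => (e d : C) := continuous_subtype_val.comp he
  exact @Continuous.comp G D C (bohrTopology G t) _ _ (e.symm.toMonoidHom.comp g)
    (fun d : D => (e d : C)) hv hc

/-- `t⁺` is the topology induced on `G` by the Bohr compactification. -/
theorem bohrTopology_eq_induced {G : Type u} [Group G] [t : TopologicalSpace G] {B : Type u}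
    [Group B] [b : TopologicalSpace B] {i : G →* B} (h : IsBohrCompactification G B i) :
    bohrTopology G t = TopologicalSpace.induced i b := by
  have := h.isTopologicalGroup
  have := h.compactSpace
  have := h.t2Space
  refine le_antisymm (continuous_iff_le_induced.1 (continuous_bohrTopology t i h.continuous)) ?_
  refine le_iInf fun C => le_iInf fun _ => le_iInf fun _ => le_iInf fun _ => le_iInf fun _ =>
    le_iInf fun _ => le_iInf fun f => le_iInf fun hf => ?_
  obtain ⟨j, hj, rfl⟩ := h.exists_lift C f hf
  rw [MonoidHom.coe_comp, ← induced_compose]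
  exact induced_mono (continuous_iff_le_induced.1 hj)

/-- Every topological group has a Bohr compactification. -/
theorem exists_isBohrCompactification (G : Type u) [Group G] [TopologicalSpace G] :
    ∃ (B : Type u) (_ : Group B) (_ : TopologicalSpace B) (i : G →* B),
      IsBohrCompactification G B i := by
  let I := Σ' (C : Type u) (_ : Group C) (c : TopologicalSpace C) (_ : IsTopologicalGroup C)
    (_ : CompactSpace C) (_ : T2Space C) (f : G →* C), Continuous f
  let F : I → Type u := fun p => p.1
  let _ : ∀ p, Group (F p) := fun p => p.2.1
  let _ : ∀ p, TopologicalSpace (F p) := fun p => p.2.2.1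
  have _ : ∀ p, IsTopologicalGroup (F p) := fun p => p.2.2.2.1
  have _ : ∀ p, CompactSpace (F p) := fun p => p.2.2.2.2.1
  have _ : ∀ p, T2Space (F p) := fun p => p.2.2.2.2.2.1
  let k : ∀ p, G →* F p := fun p => p.2.2.2.2.2.2.1
  have hk : ∀ p, Continuous (k p) := fun p => p.2.2.2.2.2.2.2
  let f : G →* ∀ p, F p := MonoidHom.pi k
  have hf : Continuous f := continuous_pi hk
  let S := f.range.topologicalClosure
  have : CompactSpace S :=
    isCompact_iff_compactSpace.1 f.range.isClosed_topologicalClosure.isCompact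
  let g : G →* S := f.codRestrict S fun x => f.range.le_topologicalClosure ⟨x, rfl⟩
  have hg : Continuous g := hf.subtype_mk _
  have hd : DenseRange g := by
    intro x
    rw [closure_subtype]
    have : (Subtype.val '' Set.range g : Set _) = f.range := by
      rw [← Set.range_comp]
      rfl
    rw [this]
    exact x.2
  obtain ⟨D, gD, tD, h1, h2, h3, e, he, he'⟩ := exists_model g hd
  refine ⟨D, gD, tD, e.symm.toMonoidHom.comp g, h1, h2, h3, he'.comp hg, ?_, ?_⟩
  · exact e.symm.surjective.denseRange.comp hd he'
  · intro C _ _ _ _ _ p hp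
    let q : I := ⟨C, inferInstance, inferInstance, inferInstance, inferInstance, inferInstance,
      p, hp⟩
    refine ⟨((Pi.evalMonoidHom F q).comp S.subtype).comp e.toMonoidHom, ?_, ?_⟩
    · exact ((continuous_apply q).comp continuous_subtype_val).comp he
    · ext x
      change p x = (e (e.symm (g x)) : ∀ p, F p) q
      rw [e.apply_symm_apply]
      rfl

end Facts

end BohrRespect

open BohrRespect

/-!
The analytic content is Glicksberg's theorem: a locally compact Abelian group `G` is maximally
almost periodic and every Bohr-compact subset of it is compact. It is derived from a weak form of
Bochner's theorem, `exists_integral_character_eq_zero`: for a neighbourhood `U` of `1` there are a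
finite measure on a compact space `Ω`, a weight `F ≥ 0` on `Ω` and a family of characters `E ω`,
continuous wherever `F ω ≠ 0` and depending continuously on `ω`, such that `∫ F ω * E ω x` vanishes
for `x ∉ U` and not for `x = 1`. Here `Ω` is the Gelfand spectrum of the commutative C⋆-algebra
generated by the translations of `L²(G)` and by one convolution operator `T`. The measure is the
spectral measure of a vector `v`, the weight is `|ω(T)|²`, and the integral is the matrix
coefficient of `T v`, where `v` and `T` are localized near `1`. Convolution makes `x ↦ π x * T` norm continuous,
which is why the characters in question are continuous although `E ω` need not be in general.

That characters separate points is immediate. If a Bohr-compact set were not compact, it would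
contain a sequence with `(a m)⁻¹ * a n ∉ U` for `m < n`. On each compact set `{F ≥ 1 / (m + 1)}` the
functions `ω ↦ E ω (a n)` have only continuous cluster points, so a subsequence converges pointwise
wherever `F ≠ 0` (`exists_strictMono_forall_tendsto`, a metrization argument in the manner of
Eberlein and Grothendieck); dominated convergence contradicts the vanishing of the integrals
outside `U`.

The statements on `k`-modifications are formal: `k(t)` has the same compact sets as `t`, and a
Hausdorff topology coarser than `t` agrees with `t` on `t`-compact sets. A precompact group embeds
in its completion, which is a compact group, so it carries its own Bohr topology.

The inclusions are proper because of the following groups. The discrete integers are not precompact.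
The finitely supported circle-valued sequences with pointwise convergence form a metrizable
precompact Abelian group that is not locally compact. The integers with their Bohr topology respect
compactness but are not a `k`-group, their `k`-modification being discrete. In the metrizable group
of all circle-valued sequences with uniform convergence, the sequences with a single term `-1` and
all other terms `1` tend to `1` in the Bohr topology only.
-/

section

open MeasureTheory WeakDual CompactlySupported Filter
open scoped ComplexConjugate ComplexStarModule InnerProductSpace Pointwise ENNReal

/-! ### A Gelfand spectral measure for a positive functional -/

/-- The Riesz–Markov–Kakutani theorem transported along the Gelfand isomorphism. -/
theorem exists_measure_integral_characterSpace {A : Type*} [CommCStarAlgebra A] (Λ : A →ₗ[ℂ] ℂ)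
    (hstar : ∀ a, Λ (star a) = conj (Λ a)) (hpos : ∀ a, 0 ≤ (Λ (star a * a)).re) :
    ∃ (_ : MeasurableSpace (characterSpace ℂ A)) (_ : BorelSpace (characterSpace ℂ A))
      (μ : Measure (characterSpace ℂ A)) (_ : IsFiniteMeasure μ),
      ∀ a, ∫ ω, ω a ∂μ = Λ a := by
  let Ω := characterSpace ℂ A
  let mΩ : MeasurableSpace Ω := borel _
  have bΩ : BorelSpace Ω := ⟨rfl⟩
  let γ := gelfandStarTransform A
  let ι : C_c(Ω, ℝ) → C(Ω, ℂ) := fun f => ⟨fun ω => (f ω : ℂ), by fun_prop⟩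
  have hΛre : ∀ a, IsSelfAdjoint a → Λ a = ((Λ a).re : ℂ) := by
    intro a ha
    have := hstar a
    rw [ha.star_eq] at this
    exact (Complex.conj_eq_iff_re.1 this.symm).symm
  let Λr : C_c(Ω, ℝ) →ₚ[ℝ] ℝ := PositiveLinearMap.mk₀
    { toFun := fun f => (Λ (γ.symm (ι f))).re
      map_add' := fun f g => by
        have : ι (f + g) = ι f + ι g := by ext; simp [ι]
        simp [this]
      map_smul' := fun c f => by
        have : ι (c • f) = (c : ℂ) • ι f := by ext; simp [ι]
        simp [this] } <| by
    intro f hf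
    let s : C(Ω, ℂ) := ⟨fun ω => (Real.sqrt (f ω) : ℂ), by fun_prop⟩
    have hs : ι f = star s * s := by
      ext ω
      have : 0 ≤ f ω := hf ω
      simp [ι, s, ← Complex.ofReal_mul, Real.mul_self_sqrt this]
    change 0 ≤ (Λ (γ.symm (ι f))).re
    rw [hs, map_mul, map_star]
    exact hpos _
  refine ⟨mΩ, bΩ, RealRMK.rieszMeasure Λr, inferInstance, ?_⟩
  -- self-adjoint elements have real Gelfand transforms
  have hsa : ∀ a, IsSelfAdjoint a → ∫ ω : Ω, ω a ∂(RealRMK.rieszMeasure Λr) = Λ a := by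
    intro a ha
    have hre : ∀ ω : Ω, ((ω a).re : ℂ) = ω a := by
      intro ω
      have : ω (star a) = conj (ω a) := map_star ω a
      rw [ha.star_eq] at this
      exact Complex.conj_eq_iff_re.1 this.symm
    let f : C_c(Ω, ℝ) := ⟨⟨fun ω => (ω a).re, by
      exact Complex.continuous_re.comp (γ a).continuous⟩, HasCompactSupport.of_compactSpace _⟩
    have h1 := RealRMK.integral_rieszMeasure Λr f
    have h2 : Λr f = (Λ a).re := by
      change (Λ (γ.symm (ι f))).re = _
      have : ι f = γ a := by
        ext ω
        exact hre ω
      rw [this, StarAlgEquiv.symm_apply_apply]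
    rw [hΛre a ha, ← h2, ← h1, ← integral_complex_ofReal]
    exact integral_congr_ae (ae_of_all _ fun ω => (hre ω).symm)
  intro a
  have hint : ∀ b, Integrable (fun ω : Ω => ω b) (RealRMK.rieszMeasure Λr) := fun b =>
    (γ b).continuous.integrable_of_hasCompactSupport (HasCompactSupport.of_compactSpace _)
  have hd := realPart_add_I_smul_imaginaryPart a
  conv_rhs => rw [← hd]
  conv_lhs => rw [← hd]
  simp only [map_add, map_smul]
  refine (integral_add (hint _) ((hint _).smul Complex.I)).trans ?_
  rw [hsa _ (ℜ a).2]
  have h := (integral_smul Complex.I fun ω : Ω => ω (ℑ a : A)).trans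
    (congrArg _ (hsa _ (ℑ a).2))
  exact congrArg _ h

/-! ### Spectral integrals for unitary representations -/

/-- A weak Bochner theorem. The space `Ω` is the Gelfand spectrum of the C⋆-algebra generated by the
unitaries `π x` and by `T`, with `E ω x = ω (π x)` and `F ω = |ω T|²`. Norm continuity of
`x ↦ π x * T` makes `E ω` continuous at all `ω` with `ω T ≠ 0`, through
`ω (π x) = ω (π x * T) / ω T`. -/
theorem exists_integral_character_eq_inner {G : Type*} [CommGroup G] [TopologicalSpace G]
    {H : Type v} [NormedAddCommGroup H] [InnerProductSpace ℂ H] [CompleteSpace H]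
    (π : G →* unitary (H →L[ℂ] H)) (T : H →L[ℂ] H)
    (hT : ∀ x, Commute (π x : H →L[ℂ] H) T) (hTn : Commute T (star T))
    (hTc : Continuous fun x => (π x : H →L[ℂ] H) * T) (v : H) :
    ∃ (Ω : Type v) (_ : TopologicalSpace Ω) (_ : CompactSpace Ω) (_ : T2Space Ω)
      (_ : MeasurableSpace Ω) (_ : BorelSpace Ω) (μ : Measure Ω) (_ : IsFiniteMeasure μ)
      (F : Ω → ℝ) (E : Ω → G →* Circle), Continuous F ∧ (∀ ω, 0 ≤ F ω) ∧
      (∀ x, Continuous fun ω => E ω x) ∧ (∀ ω, F ω ≠ 0 → Continuous (E ω)) ∧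
      ∀ x, ∫ ω, (F ω : ℂ) * (E ω x : ℂ) ∂μ = ⟪T v, (π x : H →L[ℂ] H) (T v)⟫_ℂ := by
  let s : Set (H →L[ℂ] H) := insert T (Set.range fun x => (π x : H →L[ℂ] H))
  have hππ : ∀ x y, Commute (π x : H →L[ℂ] H) (π y) := fun x y => by
    have : π x * π y = π y * π x := by rw [← map_mul, ← map_mul, mul_comm]
    exact congrArg Subtype.val this
  have hstarπ : ∀ x, star (π x : H →L[ℂ] H) = π x⁻¹ := fun x => by
    rw [map_inv]; rfl
  have hTs : ∀ x, Commute (π x : H →L[ℂ] H) (star T) := fun x => by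
    have := (hT x⁻¹).star_star
    rwa [← hstarπ, star_star] at this
  have : IsMulCommutative (StarAlgebra.adjoin ℂ s) := by
    refine StarAlgebra.isMulCommutative_adjoin ℂ ?_ ?_
    · rintro _ (rfl | ⟨x, rfl⟩) _ (rfl | ⟨y, rfl⟩)
      · rfl
      · exact (hT y).symm
      · exact hT x
      · exact hππ x y
    · rintro _ (rfl | ⟨x, rfl⟩) _ (rfl | ⟨y, rfl⟩)
      · exact hTn
      · dsimp only; rw [hstarπ]; exact (hT _).symm
      · exact hTs x
      · dsimp only; rw [hstarπ]; exact hππ _ _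
  let A := (StarAlgebra.adjoin ℂ s).topologicalClosure
  have hA : IsClosed (A : Set (H →L[ℂ] H)) := StarSubalgebra.isClosed_topologicalClosure _
  have hsA : s ⊆ A := (StarAlgebra.subset_adjoin ℂ s).trans subset_closure
  have hAc : ∀ a b : A, a * b = b * a :=
    ((StarAlgebra.adjoin ℂ s).commRingTopologicalClosure fun x y => mul_comm' x y).mul_comm
  let _ : CStarAlgebra A := StarSubalgebra.cstarAlgebra A (h_closed := hA)
  let _ : CommCStarAlgebra A := { mul_comm := hAc }
  let p : G → A := fun x => ⟨π x, hsA (Or.inr ⟨x, rfl⟩)⟩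
  let t : A := ⟨T, hsA (Or.inl rfl)⟩
  let Λ : A →ₗ[ℂ] ℂ :=
    { toFun := fun a => ⟪v, (a : H →L[ℂ] H) v⟫_ℂ
      map_add' := fun a b => by simp
      map_smul' := fun c a => by simp }
  have hΛ : ∀ a b : A, Λ (star a * b) = ⟪(a : H →L[ℂ] H) v, (b : H →L[ℂ] H) v⟫_ℂ := fun a b =>
    ContinuousLinearMap.adjoint_inner_right (a : H →L[ℂ] H) v ((b : H →L[ℂ] H) v)
  obtain ⟨_, _, μ, hμ, hint⟩ := exists_measure_integral_characterSpace Λ (fun a => by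
      have h1 := hΛ a 1
      rw [mul_one] at h1
      rw [h1]
      exact (inner_conj_symm _ _).symm) (fun a => by
      rw [hΛ]
      exact inner_self_nonneg (𝕜 := ℂ))
  have hp : ∀ x y, p (x * y) = p x * p y := fun x y => Subtype.ext (by simp [p])
  have hp1 : p 1 = 1 := Subtype.ext (by simp [p])
  have hnorm : ∀ (ω : characterSpace ℂ A) x, ‖ω (p x)‖ = 1 := by
    intro ω x
    have h1 : star (p x) * p x = 1 := Subtype.ext (Unitary.coe_star_mul_self (π x))
    have h2 : conj (ω (p x)) * ω (p x) = 1 := by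
      have h3 : ω (star (p x)) = conj (ω (p x)) := map_star ω (p x)
      rw [← h3, ← map_mul, h1, map_one]
    rw [← Complex.normSq_eq_conj_mul_self] at h2
    have h4 : Complex.normSq (ω (p x)) = 1 := by exact_mod_cast h2
    rw [Complex.norm_def, h4, Real.sqrt_one]
  let E : characterSpace ℂ A → G →* Circle := fun ω =>
    { toFun := fun x => ⟨ω (p x), mem_sphere_zero_iff_norm.2 (hnorm ω x)⟩
      map_one' := Circle.ext (by change ω (p 1) = 1; rw [hp1, map_one])
      map_mul' := fun x y => Circle.ext (by
        change ω (p (x * y)) = ω (p x) * ω (p y); rw [hp, map_mul]) }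
  have hcont : ∀ a : A, Continuous fun ω : characterSpace ℂ A => ω a := fun a =>
    (gelfandStarTransform A a).continuous
  refine ⟨characterSpace ℂ A, inferInstance, inferInstance, inferInstance, _, ‹_›, μ, hμ,
    fun ω => Complex.normSq (ω t), E, Complex.continuous_normSq.comp (hcont t),
    fun ω => Complex.normSq_nonneg _, fun x => (hcont (p x)).subtype_mk _, fun ω hω => ?_,
    fun x => ?_⟩
  · have hωt : ω t ≠ 0 := fun h => hω (by simp [h])
    have h1 : Continuous fun x => p x * t := hTc.subtype_mk fun x => (p x * t).2
    have h2 : Continuous fun x => ω (p x * t) / ω t :=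
      ((map_continuous ω).comp h1).div_const _
    refine Continuous.subtype_mk (h2.congr fun x => ?_) _
    rw [map_mul, mul_div_cancel_right₀ _ hωt]
  · have h1 := hΛ t (p x * t)
    rw [← hint] at h1
    refine Eq.trans (integral_congr_ae (ae_of_all _ fun ω => ?_)) h1
    change (Complex.normSq (ω t) : ℂ) * ω (p x) = ω (star t * (p x * t))
    have h3 : ω (star t) = conj (ω t) := map_star ω t
    rw [map_mul, map_mul, h3, Complex.normSq_eq_conj_mul_self]
    ring

/-! ### Convolution operators of a unitary representation -/

/-- The operator `T = ∫ f y • π y` attached to a compactly supported function `f`: it commutes with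
the representation, is normal, and turns the strong continuity of `π` into norm continuity. -/
theorem exists_smoothing_operator {G : Type*} [CommGroup G] [TopologicalSpace G]
    [IsTopologicalGroup G] [LocallyCompactSpace G] [MeasurableSpace G] [BorelSpace G]
    (μ : Measure G) [μ.IsHaarMeasure]
    {H : Type*} [NormedAddCommGroup H] [InnerProductSpace ℂ H] [CompleteSpace H]
    (π : G →* unitary (H →L[ℂ] H)) (hπ : ∀ v, Continuous fun x => (π x : H →L[ℂ] H) v)
    (f : G → ℝ) (hf : Continuous f) (hfc : HasCompactSupport f) :
    ∃ T : H →L[ℂ] H, (∀ v, Integrable (fun y => (f y : ℂ) • (π y : H →L[ℂ] H) v) μ) ∧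
      (∀ v, T v = ∫ y, (f y : ℂ) • (π y : H →L[ℂ] H) v ∂μ) ∧
      (∀ x, Commute (π x : H →L[ℂ] H) T) ∧ Commute T (star T) ∧
      Continuous fun x => (π x : H →L[ℂ] H) * T := by
  have hππ : ∀ x y, (π x : H →L[ℂ] H) * (π y) = π (x * y) := fun x y => by
    rw [map_mul]; rfl
  have hππv : ∀ x y v, (π x : H →L[ℂ] H) ((π y : H →L[ℂ] H) v) = (π (x * y) : H →L[ℂ] H) v :=
    fun x y v => by rw [← hππ]; rfl
  have hnorm : ∀ x v, ‖(π x : H →L[ℂ] H) v‖ = ‖v‖ := fun x v => by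
    exact (Unitary.linearIsometryEquiv (π x)).norm_map v
  have hint : ∀ (g : G → ℝ), Continuous g → HasCompactSupport g → ∀ v,
      Integrable (fun y => (g y : ℂ) • (π y : H →L[ℂ] H) v) μ := by
    intro g hg hgc v
    refine Continuous.integrable_of_hasCompactSupport
      ((Complex.continuous_ofReal.comp hg).smul (hπ v)) ?_
    refine HasCompactSupport.smul_right (hgc.comp_left (g := Complex.ofReal) rfl)
  have hbound : ∀ (g : G → ℝ) v,
      ‖∫ y, (g y : ℂ) • (π y : H →L[ℂ] H) v ∂μ‖ ≤ (∫ y, |g y| ∂μ) * ‖v‖ := by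
    intro g v
    refine (norm_integral_le_integral_norm _).trans (le_of_eq ?_)
    rw [← integral_mul_const]
    congr 1 with y
    rw [norm_smul, hnorm, Complex.norm_real, Real.norm_eq_abs]
  let T : H →L[ℂ] H := LinearMap.mkContinuous
    { toFun := fun v => ∫ y, (f y : ℂ) • (π y : H →L[ℂ] H) v ∂μ
      map_add' := fun v w => by
        rw [← integral_add (hint f hf hfc v) (hint f hf hfc w)]
        congr 1 with y
        rw [map_add, smul_add]
      map_smul' := fun c v => by
        rw [RingHom.id_apply, ← integral_smul]
        congr 1 with y
        rw [map_smul, smul_comm] } _ (hbound f)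
  have hT : ∀ v, T v = ∫ y, (f y : ℂ) • (π y : H →L[ℂ] H) v ∂μ := fun v => rfl
  -- operators commuting with all `π y` commute with `T`; used for `S = π x` and `S = star T`
  have hcomm : ∀ S : H →L[ℂ] H, (∀ y, Commute S (π y)) → Commute S T := by
    intro S hS
    ext v
    change S (T v) = T (S v)
    rw [hT, hT, ← S.integral_comp_comm (hint f hf hfc v)]
    congr 1 with y
    rw [map_smul]
    exact congrArg _ (DFunLike.congr_fun (hS y).eq v)
  have hπT : ∀ x, Commute (π x : H →L[ℂ] H) T := fun x => hcomm _ fun y => by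
    rw [Commute, SemiconjBy, hππ, hππ, mul_comm]
  refine ⟨T, hint f hf hfc, hT, hπT, ?_, ?_⟩
  · refine (hcomm _ fun y => ?_).symm
    have := (hπT y⁻¹).star_star
    rw [show star (π y⁻¹ : H →L[ℂ] H) = π y by rw [map_inv]; exact star_star _] at this
    exact this.symm
  -- translating `T` amounts to translating `f`, and translation is continuous in `L¹`
  · have hshift : ∀ x v, ((π x : H →L[ℂ] H) * T) v =
        ∫ y, (f (x⁻¹ * y) : ℂ) • (π y : H →L[ℂ] H) v ∂μ := by
      intro x v
      change (π x : H →L[ℂ] H) (T v) = _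
      rw [hT, ← (π x : H →L[ℂ] H).integral_comp_comm (hint f hf hfc v),
        ← integral_mul_left_eq_self (fun y => (f (x⁻¹ * y) : ℂ) • (π y : H →L[ℂ] H) v) x]
      congr 1 with y
      rw [map_smul, hππv, inv_mul_cancel_left]
    have hfx : ∀ x : G, Continuous fun y => f (x⁻¹ * y) := fun x => hf.comp (by fun_prop)
    have hfxc : ∀ x : G, HasCompactSupport fun y => f (x⁻¹ * y) := fun x =>
      hfc.comp_homeomorph (Homeomorph.mulLeft x⁻¹)
    rw [continuous_iff_continuousAt]
    intro x₀
    have hle : ∀ x, ‖(π x : H →L[ℂ] H) * T - (π x₀ : H →L[ℂ] H) * T‖ ≤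
        ∫ y, |f (x⁻¹ * y) - f (x₀⁻¹ * y)| ∂μ := by
      intro x
      refine ContinuousLinearMap.opNorm_le_bound _ (integral_nonneg fun _ => abs_nonneg _)
        fun v => ?_
      rw [sub_apply, hshift, hshift,
        ← integral_sub (hint _ (hfx x) (hfxc x) v) (hint _ (hfx x₀) (hfxc x₀) v)]
      refine le_trans (le_of_eq ?_) (hbound (fun y => f (x⁻¹ * y) - f (x₀⁻¹ * y)) v)
      congr 2 with y
      rw [← sub_smul, Complex.ofReal_sub]
    obtain ⟨N, hN, hxN⟩ := exists_compact_mem_nhds x₀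
    have hK : IsCompact (N * tsupport f) := hN.mul hfc
    have hcont : ContinuousOn (fun x => ∫ y, |f (x⁻¹ * y) - f (x₀⁻¹ * y)| ∂μ) N := by
      refine continuousOn_integral_of_compact_support hK (Continuous.continuousOn ?_) ?_
      · fun_prop
      · intro x y hx hy
        have key : ∀ x ∈ N, f (x⁻¹ * y) = 0 := by
          intro x hx
          by_contra h
          exact hy ⟨x, hx, x⁻¹ * y, subset_tsupport _ h, by simp⟩
        rw [key x hx, key x₀ (mem_of_mem_nhds hxN), sub_zero, abs_zero]
    have hca := hcont.continuousAt hxN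
    rw [ContinuousAt, tendsto_iff_norm_sub_tendsto_zero]
    refine squeeze_zero (fun _ => norm_nonneg _) hle ?_
    have := hca.tendsto
    simpa using this

/-! ### Characters of a locally compact Abelian group -/

section Regular
variable {G : Type u} [CommGroup G] [TopologicalSpace G] [IsTopologicalGroup G]
  [MeasurableSpace G] [BorelSpace G]

/-- The unitary representation of an Abelian group on `L²`, where `x` sends `v` to `y ↦ v (x * y)`.
This is multiplicative in `x`, without inverses, because the group is commutative. -/
noncomputable def regularRepresentation (μ : Measure G) [μ.IsHaarMeasure] :
    G →* unitary (Lp ℂ 2 μ →L[ℂ] Lp ℂ 2 μ) :=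
  Unitary.linearIsometryEquiv.symm.toMonoidHom.comp
    { toFun := fun x =>
        { toFun := fun v => DomMulAct.mk x • v
          invFun := fun v => DomMulAct.mk x⁻¹ • v
          left_inv := fun v => by
            beta_reduce
            rw [smul_smul, ← DomMulAct.mk_mul, mul_inv_cancel,
              DomMulAct.mk_one, one_smul]
          right_inv := fun v => by
            beta_reduce
            rw [smul_smul, ← DomMulAct.mk_mul, inv_mul_cancel,
              DomMulAct.mk_one, one_smul]
          map_add' := fun v w => DomMulAct.smul_Lp_add _ v w
          map_smul' := fun c v => smul_comm _ c v
          norm_map' := fun v => DomMulAct.norm_smul_Lp _ v }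
      map_one' := by
        ext1 v
        exact one_smul (DomMulAct G) v
      map_mul' := fun x y => by
        ext1 v
        change DomMulAct.mk (x * y) • v = DomMulAct.mk x • DomMulAct.mk y • v
        rw [smul_smul, ← DomMulAct.mk_mul, mul_comm] }

theorem regularRepresentation_apply (μ : Measure G) [μ.IsHaarMeasure] (x : G) (v : Lp ℂ 2 μ) :
    (regularRepresentation μ x : Lp ℂ 2 μ →L[ℂ] Lp ℂ 2 μ) v = DomMulAct.mk x • v := rfl

theorem continuous_regularRepresentation [LocallyCompactSpace G] (μ : Measure G) [μ.IsHaarMeasure]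
    [μ.InnerRegularCompactLTTop] (v : Lp ℂ 2 μ) :
    Continuous fun x => (regularRepresentation μ x : Lp ℂ 2 μ →L[ℂ] Lp ℂ 2 μ) v := by
  have : Fact ((2 : ℝ≥0∞) ≠ ∞) := ⟨by simp⟩
  simp only [regularRepresentation_apply]
  exact DomMulAct.continuous_mk.smul continuous_const

theorem inner_regularRepresentation_indicator (μ : Measure G) [μ.IsHaarMeasure] {S : Set G}
    (hS : MeasurableSet S) (hμ : μ S ≠ ∞) {x y : G} (h : ∀ s ∈ S, ∀ t ∈ S, x * t ≠ y * s) :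
    ⟪(regularRepresentation μ x : Lp ℂ 2 μ →L[ℂ] Lp ℂ 2 μ) (indicatorConstLp 2 hS hμ 1),
      (regularRepresentation μ y : Lp ℂ 2 μ →L[ℂ] Lp ℂ 2 μ) (indicatorConstLp 2 hS hμ 1)⟫_ℂ = 0 := by
  simp only [regularRepresentation_apply, DomMulAct.mk_smul_indicatorConstLp]
  rw [L2.inner_indicatorConstLp_one_indicatorConstLp_one
    (hμs := by rwa [measure_preimage_smul]) (hμt := by rwa [measure_preimage_smul])]
  have : (x • ·) ⁻¹' S ∩ (y • ·) ⁻¹' S = (∅ : Set G) := by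
    refine Set.eq_empty_of_forall_notMem ?_
    rintro z ⟨h1, h2⟩
    exact h _ h1 _ h2 (by simp only [smul_eq_mul]; rw [mul_left_comm])
  rw [this]
  simp

end Regular

/-- The matrix coefficient of `T v` vanishes off `U` when the translates of `v` by `V` and by `x *
V` are orthogonal for `x ∉ U`; here `T` averages over a bump function supported in `V` and so close
to `1` that `T v ≠ 0`. -/
theorem exists_integral_character_eq_zero_of_unitary {G : Type*} [CommGroup G]
    [TopologicalSpace G] [IsTopologicalGroup G] [LocallyCompactSpace G]
    {H : Type v} [NormedAddCommGroup H] [InnerProductSpace ℂ H] [CompleteSpace H]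
    (π : G →* unitary (H →L[ℂ] H)) (hπ : ∀ v, Continuous fun x => (π x : H →L[ℂ] H) v)
    {v : H} (hv : v ≠ 0) {U V : Set G} (hV : V ∈ 𝓝 1) (key : ∀ x ∉ U, ∀ y ∈ V, ∀ z ∈ V,
      ⟪(π y : H →L[ℂ] H) v, (π (x * z) : H →L[ℂ] H) v⟫_ℂ = 0) :
    ∃ (Ω : Type v) (_ : TopologicalSpace Ω) (_ : CompactSpace Ω) (_ : T2Space Ω)
      (_ : MeasurableSpace Ω) (_ : BorelSpace Ω) (μ : Measure Ω) (_ : IsFiniteMeasure μ)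
      (F : Ω → ℝ) (E : Ω → G →* Circle), Continuous F ∧ (∀ ω, 0 ≤ F ω) ∧
      (∀ x, Continuous fun ω => E ω x) ∧ (∀ ω, F ω ≠ 0 → Continuous (E ω)) ∧
      (∀ x ∉ U, ∫ ω, (F ω : ℂ) * (E ω x : ℂ) ∂μ = 0) ∧ ∫ ω, (F ω : ℂ) ∂μ ≠ 0 := by
  let _ : MeasurableSpace G := borel G
  have : BorelSpace G := ⟨rfl⟩
  let μ : Measure G := Measure.haar
  have hW : {y | ‖(π y : H →L[ℂ] H) v - v‖ < ‖v‖ / 2} ∈ 𝓝 (1 : G) := by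
    have h1 : Continuous fun y => ‖(π y : H →L[ℂ] H) v - v‖ := ((hπ v).sub continuous_const).norm
    refine h1.continuousAt.eventually_lt continuousAt_const ?_
    simp only [map_one, OneMemClass.coe_one, one_apply_eq_self, sub_self, norm_zero]
    exact half_pos (norm_pos_iff.2 hv)
  obtain ⟨W, hWsub, hWo, h1W⟩ := mem_nhds_iff.1 (inter_mem hW hV)
  obtain ⟨f, hf1, hf0, hfc, hf⟩ := exists_continuous_one_zero_of_isCompact
    (isCompact_singleton (x := (1 : G))) hWo.isClosed_compl (by simpa using h1W)
  have hfW : ∀ y, f y ≠ 0 → y ∈ W := fun y hy => by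
    by_contra h
    exact hy (hf0 h)
  obtain ⟨T, hTi, hT, hTπ, hTn, hTc⟩ := exists_smoothing_operator μ π hπ f f.continuous hfc
  have hTv : T v ≠ 0 := by
    have hfi : Integrable f μ := f.continuous.integrable_of_hasCompactSupport hfc
    have hpos : 0 < ∫ y, f y ∂μ :=
      f.continuous.integral_pos_of_hasCompactSupport_nonneg_nonzero hfc (fun y => (hf y).1)
        (x := 1) (by rw [hf1 rfl]; simp)
    have h1 : ‖T v - (∫ y, f y ∂μ : ℝ) • v‖ ≤ (∫ y, f y ∂μ) * (‖v‖ / 2) := by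
      rw [hT, ← integral_smul_const, ← integral_sub (hTi v) (hfi.smul_const v),
        ← integral_mul_const]
      refine norm_integral_le_of_norm_le (hfi.mul_const _) (ae_of_all _ fun y => ?_)
      rw [Complex.coe_smul, ← smul_sub, norm_smul, Real.norm_of_nonneg (hf y).1]
      by_cases hy : f y = 0
      · simp [hy]
      · exact mul_le_mul_of_nonneg_left (hWsub (hfW y hy)).1.le (hf y).1
    intro h
    rw [h, zero_sub, norm_neg, norm_smul, Real.norm_of_nonneg hpos.le] at h1
    have := le_of_mul_le_mul_left h1 hpos
    have := norm_pos_iff.2 hv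
    linarith
  obtain ⟨Ω, _, _, _, _, _, ν, hν, F, E, hF, hF0, hE, hEc, hint⟩ :=
    exists_integral_character_eq_inner π T hTπ hTn hTc v
  refine ⟨Ω, _, ‹_›, ‹_›, _, ‹_›, ν, hν, F, E, hF, hF0, hE, hEc, fun x hx => ?_, ?_⟩
  · rw [hint]
    have hππ : ∀ x y v, (π x : H →L[ℂ] H) ((π y : H →L[ℂ] H) v) = (π (x * y) : H →L[ℂ] H) v :=
      fun x y v => by rw [map_mul]; rfl
    have h1 : ∀ y ∈ W, ⟪(π y : H →L[ℂ] H) v, (π x : H →L[ℂ] H) (T v)⟫_ℂ = 0 := by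
      intro y hy
      rw [hT, ← (π x : H →L[ℂ] H).integral_comp_comm (hTi v),
        ← integral_inner ((π x : H →L[ℂ] H).integrable_comp (hTi v))]
      refine integral_eq_zero_of_ae (ae_of_all _ fun z => ?_)
      simp only [map_smul, hππ, inner_smul_right, Pi.zero_apply, mul_eq_zero]
      by_cases hz : f z = 0
      · simp [hz]
      · exact Or.inr (key x hx y (hWsub hy).2 z (hWsub (hfW z hz)).2)
    rw [← inner_conj_symm, hT v, ← integral_inner (hTi v), integral_eq_zero_of_ae, map_zero]
    refine ae_of_all _ fun y => ?_
    simp only [inner_smul_right, Pi.zero_apply, mul_eq_zero]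
    by_cases hy : f y = 0
    · simp [hy]
    · right
      rw [← inner_conj_symm, ← hT, h1 y (hfW y hy), map_zero]
  · have h1 := hint 1
    simp only [map_one, Circle.coe_one, mul_one, OneMemClass.coe_one,
      one_apply_eq_self] at h1
    rw [h1]
    exact inner_self_ne_zero.2 hTv

/-- A neighbourhood of `1` in a locally compact Abelian group is singled out by an integral of
characters. The characters `E ω` may be discontinuous where the weight `F` vanishes. -/
theorem exists_integral_character_eq_zero {G : Type u} [CommGroup G] [TopologicalSpace G]
    [IsTopologicalGroup G] [LocallyCompactSpace G] [T2Space G] {U : Set G} (hU : U ∈ 𝓝 1) :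
    ∃ (Ω : Type u) (_ : TopologicalSpace Ω) (_ : CompactSpace Ω) (_ : T2Space Ω)
      (_ : MeasurableSpace Ω) (_ : BorelSpace Ω) (μ : Measure Ω) (_ : IsFiniteMeasure μ)
      (F : Ω → ℝ) (E : Ω → G →* Circle), Continuous F ∧ (∀ ω, 0 ≤ F ω) ∧
      (∀ x, Continuous fun ω => E ω x) ∧ (∀ ω, F ω ≠ 0 → Continuous (E ω)) ∧
      (∀ x ∉ U, ∫ ω, (F ω : ℂ) * (E ω x : ℂ) ∂μ = 0) ∧ ∫ ω, (F ω : ℂ) ∂μ ≠ 0 := by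
  let _ : MeasurableSpace G := borel G
  have : BorelSpace G := ⟨rfl⟩
  let μ : Measure G := Measure.haar
  obtain ⟨V₀, hV₀, hV₀U⟩ := exists_nhds_one_split4 hU
  let V := V₀ ∩ V₀⁻¹
  have hV : V ∈ 𝓝 (1 : G) := inter_mem hV₀ (inv_mem_nhds_one G hV₀)
  obtain ⟨S, hSn, hSV, hSc⟩ := local_compact_nhds hV
  have hμS : μ S ≠ ∞ := hSc.measure_ne_top
  let v : Lp ℂ 2 μ := indicatorConstLp 2 hSc.measurableSet hμS 1
  have hv : v ≠ 0 := by
    have h1 : μ S ≠ 0 := (μ.measure_pos_of_mem_nhds hSn).ne'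
    intro h
    have h2 : ‖v‖ = _ := norm_indicatorConstLp (by simp) (by simp)
    rw [h, norm_zero, norm_one, one_mul] at h2
    have h3 : 0 < μ.real S := ENNReal.toReal_pos h1 hμS
    exact (Real.rpow_pos_of_pos h3 _).ne h2
  refine exists_integral_character_eq_zero_of_unitary (regularRepresentation μ)
    (continuous_regularRepresentation μ) hv hV fun x hx y hy z hz =>
      inner_regularRepresentation_indicator μ hSc.measurableSet hμS fun s hs t ht h => hx ?_
  have : x = y * t * s⁻¹ * z⁻¹ := by
    rw [h, mul_inv_cancel_right, mul_inv_cancel_right]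
  rw [this]
  exact hV₀U hy.1 (hSV ht).1 (hSV hs).2 hz.2

/-! ### Bohr-compact sets in locally compact Abelian groups -/

theorem le_bohrTopology (G : Type u) [Group G] (t : TopologicalSpace G) : t ≤ bohrTopology G t :=
  le_iInf fun _ => le_iInf fun _ => le_iInf fun _ => le_iInf fun _ => le_iInf fun _ =>
    le_iInf fun _ => le_iInf fun _ => le_iInf fun hf => continuous_iff_le_induced.1 hf

theorem exists_character_ne_one {G : Type u} [CommGroup G] [TopologicalSpace G]
    [IsTopologicalGroup G] [LocallyCompactSpace G] [T2Space G] {x : G} (hx : x ≠ 1) :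
    ∃ χ : G →* Circle, Continuous χ ∧ χ x ≠ 1 := by
  by_contra! h
  obtain ⟨Ω, _, _, _, _, _, μ, hμ, F, E, hF, hF0, hE, hEc, h0, h1⟩ :=
    exists_integral_character_eq_zero (isOpen_compl_singleton.mem_nhds hx.symm)
  refine h1 ((integral_congr_ae (ae_of_all _ fun ω => ?_)).trans (h0 x (by simp)))
  by_cases hω : F ω = 0
  · simp [hω]
  · simp [h (E ω) (hEc ω hω)]

theorem isMAP_of_locallyCompactSpace {G : Type u} [CommGroup G] [t : TopologicalSpace G]
    [IsTopologicalGroup G] [LocallyCompactSpace G] [T2Space G] : IsMAP G := by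
  have hsep := fun (x y : G) (hxy : x ≠ y) => exists_character_ne_one (div_ne_one.2 hxy)
  let _ : TopologicalSpace G := bohrTopology G t
  refine ⟨fun x y hxy => ?_⟩
  obtain ⟨χ, hχ, h⟩ := hsep x y hxy
  have hc := continuous_bohrTopology t χ hχ
  refine separated_by_continuous hc fun h' => h ?_
  rw [map_div, h', div_self']

/-- Extraction of a pointwise convergent subsequence. If all ultrafilter limits of a sequence of
continuous functions on compact sets are continuous, these limits factor through the separable
metrizable space of sequences `n ↦ a n ω`, so they are determined by countably many points, where
a diagonal subsequence converges. -/
theorem exists_strictMono_forall_tendsto {Ω : Type*} [TopologicalSpace Ω] [CompactSpace Ω]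
    {K : ℕ → Set Ω} (hK : ∀ m, IsClosed (K m)) {a : ℕ → Ω → Circle} (ha : ∀ n, Continuous (a n))
    (h : ∀ 𝒰 : Ultrafilter ℕ, ∃ b : Ω → Circle, Continuous b ∧
      ∀ m, ∀ ω ∈ K m, Tendsto (fun n => a n ω) 𝒰 (𝓝 (b ω))) :
    ∃ φ : ℕ → ℕ, StrictMono φ ∧ ∃ b : Ω → Circle,
      ∀ m, ∀ ω ∈ K m, Tendsto (fun k => a (φ k) ω) atTop (𝓝 (b ω)) := by
  choose b hbc hb using h
  -- `Φ` identifies the points of `Ω` that the sequence does not distinguish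
  let Φ : Ω → ℕ → Circle := fun ω n => a n ω
  have hΦ : Continuous Φ := continuous_pi ha
  have hC : ∀ m, ∃ c ⊆ Φ '' K m, c.Countable ∧ Φ '' K m ⊆ closure c := fun m =>
    (TopologicalSpace.IsSeparable.of_separableSpace (Φ '' K m)).exists_countable_dense_subset
  choose C hCK hCc hCd using hC
  have : Countable (⋃ m, C m) := (Set.countable_iUnion hCc).to_subtype
  obtain ⟨l, φ, hφ, hl⟩ := CompactSpace.tendsto_subseq
    (fun (n : ℕ) (c : ⋃ m, C m) => (c : ℕ → Circle) n)
  refine ⟨φ, hφ, b ((hyperfilter ℕ).map φ), fun m ω hω => ?_⟩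
  have hdense : ∀ c ∈ C m, ∃ z, Tendsto (fun k => c (φ k)) atTop (𝓝 z) := fun c hc =>
    ⟨_, (tendsto_pi_nhds.1 hl) ⟨c, Set.mem_iUnion.2 ⟨m, hc⟩⟩⟩
  have hlim : ∀ (𝒱 : Ultrafilter ℕ), ∀ ω ∈ K m,
      Tendsto (fun k => a (φ k) ω) 𝒱 (𝓝 (b (𝒱.map φ) ω)) := fun 𝒱 ω hω => hb (𝒱.map φ) m ω hω
  rw [tendsto_iff_ultrafilter]
  intro 𝒱 h𝒱
  -- the cluster points along `𝒱` and along the hyperfilter agree on a compact set `Z`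
  -- whose image under `Φ` contains a dense subset of `Φ '' K m`
  let Z : Set Ω := K m ∩ {ω | b (𝒱.map φ) ω = b ((hyperfilter ℕ).map φ) ω}
  have hZ : IsClosed (Φ '' Z) :=
    (((hK m).inter (isClosed_eq (hbc _) (hbc _))).isCompact.image hΦ).isClosed
  have hCZ : C m ⊆ Φ '' Z := by
    intro c hc
    obtain ⟨ω', hω', rfl⟩ := hCK m hc
    obtain ⟨z, hz⟩ := hdense _ hc
    refine ⟨ω', ⟨hω', ?_⟩, rfl⟩
    exact (tendsto_nhds_unique (hlim 𝒱 ω' hω') (hz.mono_left h𝒱)).trans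
      (tendsto_nhds_unique (hlim (hyperfilter ℕ) ω' hω')
        (hz.mono_left Nat.hyperfilter_le_atTop)).symm
  obtain ⟨ω', ⟨hω'K, hω'⟩, hΦω⟩ := (hCd m).trans (closure_minimal hCZ hZ) ⟨ω, hω, rfl⟩
  have hab : ∀ k, a (φ k) ω' = a (φ k) ω := fun k => congrFun hΦω (φ k)
  have h1 := hlim (hyperfilter ℕ) ω' hω'K
  simp only [hab] at h1
  have h2 := hlim 𝒱 ω' hω'K
  simp only [hab] at h2
  rw [tendsto_nhds_unique (hlim (hyperfilter ℕ) ω hω) h1, ← hω']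
  exact h2

/-- **Glicksberg's theorem**: Bohr-compact subsets of a locally compact Abelian group are compact.
-/
theorem isCompact_of_isCompact_bohrTopology {G : Type u} [CommGroup G] [t : TopologicalSpace G]
    [IsTopologicalGroup G] [LocallyCompactSpace G] [T2Space G] {A : Set G}
    (hA : @IsCompact G (bohrTopology G t) A) : IsCompact A := by
  have hcl : IsClosed A := by
    have : @IsClosed G (bohrTopology G t) A :=
      @IsCompact.isClosed G (bohrTopology G t) isMAP_of_locallyCompactSpace A hA
    exact this.mono (le_bohrTopology G t)
  obtain ⟨U, hUc, hU⟩ := exists_compact_mem_nhds (1 : G)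
  by_cases hfin : ∃ s : Finset G, A ⊆ ⋃ x ∈ s, x • U
  · obtain ⟨s, hs⟩ := hfin
    exact (s.isCompact_biUnion fun x _ => hUc.smul x).of_isClosed_subset hcl hs
  exfalso
  obtain ⟨a, haA, ha⟩ := exists_seq_of_forall_finset_exists (· ∈ A) (fun x y => x⁻¹ * y ∉ U) (by
    intro s _
    obtain ⟨y, hyA, hy⟩ := Set.not_subset.1 (not_exists.1 hfin s)
    refine ⟨y, hyA, fun x hx hxy => hy ?_⟩
    exact Set.mem_biUnion hx (Set.mem_smul_set_iff_inv_smul_mem.2 hxy))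
  obtain ⟨Ω, _, _, _, _, _, μ, hμ, F, E, hF, hF0, hE, hEc, h0, h1⟩ :=
    exists_integral_character_eq_zero hU
  obtain ⟨φ, hφ, b, hb⟩ := exists_strictMono_forall_tendsto
    (K := fun m => {ω | 1 / ((m : ℝ) + 1) ≤ F ω}) (a := fun n ω => E ω (a n))
    (fun m => isClosed_le continuous_const hF) (fun n => hE (a n)) (by
      intro 𝒰
      obtain ⟨x, -, hx⟩ := @IsCompact.ultrafilter_le_nhds G (bohrTopology G t) A hA (𝒰.map a)
        (by
          rw [le_principal_iff]
          exact Filter.mem_map.2 (univ_mem' haA))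
      refine ⟨fun ω => E ω x, hE x, fun m ω hω => ?_⟩
      have hω' : F ω ≠ 0 := (lt_of_lt_of_le Nat.one_div_pos_of_nat hω).ne'
      have hc := continuous_bohrTopology t (E ω) (hEc ω hω')
      exact (@Continuous.tendsto G Circle (bohrTopology G t) _ _ hc x).comp hx)
  -- consecutive terms of the subsequence become close at each `ω` with `F ω ≠ 0`
  have hlim : ∀ ω, Tendsto
      (fun k => (F ω : ℂ) * (E ω ((a (φ k))⁻¹ * a (φ (k + 1))) : ℂ)) atTop (𝓝 (F ω : ℂ)) := by
    intro ω
    by_cases hω : F ω = 0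
    · simp [hω]
    obtain ⟨m, hm⟩ := exists_nat_one_div_lt ((hF0 ω).lt_of_ne' hω)
    have h2 := hb m ω hm.le
    have h3 := (h2.inv.mul (h2.comp (tendsto_add_atTop_nat 1)))
    rw [inv_mul_cancel] at h3
    have h4 := ((by fun_prop : Continuous fun z : Circle => (z : ℂ)).tendsto _).comp h3
    have h5 := h4.const_mul (F ω : ℂ)
    simpa using h5
  have hint := tendsto_integral_of_dominated_convergence (μ := μ) F
    (fun k => by
      have := (hE ((a (φ k))⁻¹ * a (φ (k + 1))))
      exact (by fun_prop : Continuous fun ω =>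
        (F ω : ℂ) * (E ω ((a (φ k))⁻¹ * a (φ (k + 1))) : ℂ)).aestronglyMeasurable)
    (hF.integrable_of_hasCompactSupport (HasCompactSupport.of_compactSpace _))
    (fun k => ae_of_all _ fun ω => by
      rw [norm_mul, Circle.norm_coe, mul_one, Complex.norm_real, Real.norm_of_nonneg (hF0 ω)])
    (ae_of_all _ hlim)
  simp only [h0 _ (ha _ _ (hφ (Nat.lt_succ_self _)))] at hint
  exact h1 (tendsto_nhds_unique hint tendsto_const_nhds)

/-! ### Compact sets and the k-modification -/

section Compact

variable {X : Type*} {s t : TopologicalSpace X} {K : Set X}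

theorem isCompact_of_induced_eq
    (h : TopologicalSpace.induced (Subtype.val : K → X) s =
      TopologicalSpace.induced (Subtype.val : K → X) t) (hK : @IsCompact X t K) :
    @IsCompact X s K := by
  have h1 := (@isCompact_iff_compactSpace X t K).1 hK
  refine (@isCompact_iff_compactSpace X s K).2 ?_
  change @CompactSpace K (TopologicalSpace.induced Subtype.val s)
  rw [h]
  exact h1

theorem isCompact_of_le (h : t ≤ s) (hK : @IsCompact X t K) : @IsCompact X s K := by
  have := @IsCompact.image X X t s K id hK (continuous_id_iff_le.2 h)
  rwa [Set.image_id] at this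

theorem eq_of_le_of_compactSpace_of_t2Space (h : t ≤ s) (ht : @CompactSpace X t)
    (hs : @T2Space X s) : t = s := by
  have h1 := @Continuous.isClosedEmbedding X X t s ht hs id (continuous_id_iff_le.2 h)
    Function.injective_id
  have h2 := @IsInducing.eq_induced X X t s id (@IsClosedEmbedding.isInducing X X id t s h1)
  exact h2.trans (@induced_id X s)

/-- A coarser Hausdorff topology agrees with the given one on compact sets. -/
theorem induced_eq_induced_of_isCompact (h : t ≤ s) (hs : @T2Space X s) (hK : @IsCompact X t K) :
    TopologicalSpace.induced (Subtype.val : K → X) t =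
      TopologicalSpace.induced (Subtype.val : K → X) s :=
  eq_of_le_of_compactSpace_of_t2Space (induced_mono h)
    ((@isCompact_iff_compactSpace X t K).1 hK) (@instT2SpaceSubtype X s _ hs)

end Compact

section KTopology

variable {G : Type u} [Group G]

theorem kTopology_le (t : TopologicalSpace G) (ht : @IsTopologicalGroup G t _) :
    kTopology G t ≤ t :=
  (kTopology_spec G t ht).2.2 t ht fun _ _ => rfl

theorem isCompact_kTopology_iff (t : TopologicalSpace G) (ht : @IsTopologicalGroup G t _)
    {K : Set G} : @IsCompact G (kTopology G t) K ↔ @IsCompact G t K :=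
  ⟨isCompact_of_le (kTopology_le t ht),
    fun hK => isCompact_of_induced_eq ((kTopology_spec G t ht).2.1 K hK) hK⟩

/-- The `k`-modification depends only on the compact sets and on the topology they carry. -/
theorem kTopology_eq_of_isCompact_iff {s t : TopologicalSpace G} (hts : t ≤ s)
    (hs : @T2Space G s) (h : ∀ K : Set G, @IsCompact G t K ↔ @IsCompact G s K) :
    kTopology G s = kTopology G t := by
  unfold kTopology
  congr 2
  ext r
  refine forall_congr' fun K => ?_
  rw [← h K]
  refine forall_congr' fun hK => ?_
  rw [induced_eq_induced_of_isCompact hts hs hK]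

/-- A homomorphism out of a `k`-group is continuous as soon as it is so on compact sets. -/
theorem BohrRespect.IsKGroup.continuous_of_continuousOn {H : Type v} [t : TopologicalSpace G]
    [IsTopologicalGroup G] [Group H] [TopologicalSpace H] [IsTopologicalGroup H]
    (hG : IsKGroup G) (φ : G →* H) (h : ∀ K : Set G, IsCompact K → ContinuousOn φ K) :
    Continuous φ := by
  have hle : kTopology G t ≤ t ⊓ TopologicalSpace.induced φ inferInstance := by
    refine (kTopology_spec G t inferInstance).2.2 _
      (topologicalGroup_inf inferInstance (topologicalGroup_induced φ)) fun K hK => ?_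
    rw [induced_inf, induced_compose, inf_eq_left]
    exact continuous_iff_le_induced.1 (continuousOn_iff_continuous_domRestrict.1 (h K hK))
  rw [hG] at hle
  exact continuous_iff_le_induced.2 (hle.trans inf_le_right)

theorem isKGroup_iff_le [t : TopologicalSpace G] [IsTopologicalGroup G] :
    IsKGroup G ↔ t ≤ kTopology G t :=
  ⟨fun h => h.ge, fun h => le_antisymm (kTopology_le t inferInstance) h⟩

theorem isKGroup_of_compactlyCoherentSpace [t : TopologicalSpace G] [IsTopologicalGroup G]
    [CompactlyCoherentSpace G] : IsKGroup G := by
  refine isKGroup_iff_le.2 (continuous_id_iff_le.1 ?_)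
  refine (@IsCoherentWith.continuous_iff G t _ G (kTopology G t) id
    CompactlyCoherentSpace.isCoherentWith).2 fun K hK => ?_
  rw [@continuousOn_iff_continuous_domRestrict G G t (kTopology G t)]
  exact continuous_iff_le_induced.2 ((kTopology_spec G t inferInstance).2.1 K hK).ge

end KTopology

/-! ### Bohr topologies and precompact groups -/

section BohrTopology

variable {G : Type u} [Group G]

theorem isTopologicalGroup_bohrTopology (t : TopologicalSpace G) :
    @IsTopologicalGroup G (bohrTopology G t) _ := by
  obtain ⟨B, _, _, i, hi⟩ := exists_isBohrCompactification G
  have := hi.isTopologicalGroup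
  rw [bohrTopology_eq_induced hi]
  exact topologicalGroup_induced i

/-- A group topology induced by a homomorphism to a compact group is its own Bohr topology. -/
theorem bohrTopology_eq_self_of_induced {C : Type v} [Group C] [c : TopologicalSpace C]
    [IsTopologicalGroup C] [CompactSpace C] [T2Space C] {t : TopologicalSpace G} (f : G →* C)
    (h : t = TopologicalSpace.induced f c) : bohrTopology G t = t := by
  refine le_antisymm ?_ (le_bohrTopology G t)
  conv_rhs => rw [h]
  exact continuous_iff_le_induced.1 (continuous_bohrTopology t f (continuous_iff_le_induced.2 h.le))

theorem bohrTopology_bohrTopology (t : TopologicalSpace G) :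
    bohrTopology G (bohrTopology G t) = bohrTopology G t := by
  obtain ⟨B, _, _, i, hi⟩ := exists_isBohrCompactification G
  have := hi.isTopologicalGroup
  have := hi.compactSpace
  have := hi.t2Space
  exact bohrTopology_eq_self_of_induced i (bohrTopology_eq_induced hi)

theorem mem_RC_of_bohrTopology_eq (X : TG.{u})
    (h : bohrTopology X X.topologicalSpace = X.topologicalSpace) : X ∈ RC := by
  refine ⟨?_, fun K => ?_⟩
  · unfold IsMAP
    rw [h]
    exact X.t2Space
  · rw [h]

end BohrTopology

section Precompact

/-- Conjugation in a precompact group is equicontinuous at `1`; equivalently, the left and right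
uniformities coincide. -/
theorem BohrRespect.IsPrecompactGroup.exists_conj_mem {G : Type*} [Group G] [TopologicalSpace G]
    [IsTopologicalGroup G] (h : IsPrecompactGroup G) {U : Set G} (hU : U ∈ 𝓝 1) :
    ∃ V ∈ 𝓝 (1 : G), ∀ x, ∀ y ∈ V, x * y * x⁻¹ ∈ U := by
  obtain ⟨W₀, hW₀, hW₀U⟩ := exists_nhds_one_split4 hU
  let W := W₀ ∩ W₀⁻¹
  have hW : W ∈ 𝓝 (1 : G) := inter_mem hW₀ (inv_mem_nhds_one G hW₀)
  obtain ⟨F, hF, -, hFW⟩ := h W hW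
  refine ⟨⋂ a ∈ F, (fun y => a * y * a⁻¹) ⁻¹' W, (biInter_mem hF).2 fun a _ => ?_, ?_⟩
  · refine (by fun_prop : Continuous fun y => a * y * a⁻¹).continuousAt.preimage_mem_nhds ?_
    simpa using hW
  · intro x y hy
    obtain ⟨a, ha, b, hb, rfl⟩ := hFW x
    have h1 : a * y * a⁻¹ ∈ W := Set.mem_iInter₂.1 hy a ha
    have h2 := hW₀U hb.1 h1.1 hb.2 (mem_of_mem_nhds hW₀)
    convert h2 using 1
    group

/-- A precompact group carries the topology induced by a homomorphism to a compact Hausdorff group,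
namely its completion for the uniformity that is both the left and the right one. -/
theorem BohrRespect.IsPrecompactGroup.exists_isInducing {G : Type u} [Group G]
    [t : TopologicalSpace G] [IsTopologicalGroup G] (h : IsPrecompactGroup G) :
    ∃ (C : Type u) (_ : Group C) (c : TopologicalSpace C) (_ : IsTopologicalGroup C)
      (_ : CompactSpace C) (_ : T2Space C) (f : G →* C), t = TopologicalSpace.induced f c := by
  let _ : UniformSpace G := IsTopologicalGroup.rightUniformSpace G
  have hr : IsRightUniformGroup G := ⟨rfl⟩
  have hl : IsLeftUniformGroup G := by
    refine ⟨?_⟩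
    rw [hr.uniformity_eq]
    refine le_antisymm (tendsto_iff_comap.1 fun U hU => ?_) (tendsto_iff_comap.1 fun U hU => ?_)
    · obtain ⟨V, hV, hVU⟩ := h.exists_conj_mem hU
      refine ⟨V, hV, fun p hp => ?_⟩
      simpa [mul_assoc] using hVU p.1⁻¹ _ hp
    · obtain ⟨V, hV, hVU⟩ := h.exists_conj_mem hU
      refine ⟨V, hV, fun p hp => ?_⟩
      simpa using hVU p.1 _ hp
  have : IsUniformGroup G := IsUniformGroup.of_left_right
  have : IsUniformAddGroup (Additive G) :=
    ⟨IsUniformGroup.uniformContinuous_div (α := G)⟩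
  have htb : TotallyBounded (Set.univ : Set G) := by
    intro d hd
    rw [hr.uniformity_eq] at hd
    obtain ⟨U, hU, hUd⟩ := hd
    obtain ⟨F, hF, -, hFU⟩ := h U⁻¹ (inv_mem_nhds_one G hU)
    refine ⟨F, hF, fun x _ => ?_⟩
    obtain ⟨a, ha, b, hb, rfl⟩ := hFU x
    exact Set.mem_biUnion ha (hUd (by simpa using hb))
  have : CompactSpace (UniformSpace.Completion (Additive G)) := by
    have h1 : TotallyBounded (Set.univ : Set (UniformSpace.Completion (Additive G))) := by
      rw [← UniformSpace.Completion.denseRange_coe.closure_range, totallyBounded_closure,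
        ← Set.image_univ]
      exact TotallyBounded.image (α := Additive G) htb
        (UniformSpace.Completion.uniformContinuous_coe (Additive G))
    exact isCompact_univ_iff.1 (isCompact_iff_totallyBounded_isComplete.2
      ⟨h1, completeSpace_iff_isComplete_univ.1 inferInstance⟩)
  refine ⟨Multiplicative (UniformSpace.Completion (Additive G)), inferInstance, inferInstance,
    inferInstance, ‹_›, inferInstanceAs (T2Space (UniformSpace.Completion (Additive G))),
    AddMonoidHom.toMultiplicativeRight (UniformSpace.Completion.toCompl (α := Additive G)), ?_⟩
  exact (UniformSpace.Completion.isUniformInducing_coe (Additive G)).isInducing.eq_induced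

theorem PCom_subset_RC : PCom.{u} ⊆ RC := by
  intro X hX
  obtain ⟨C, _, _, _, _, _, f, hf⟩ := IsPrecompactGroup.exists_isInducing hX
  exact mem_RC_of_bohrTopology_eq X (bohrTopology_eq_self_of_induced f hf)

end Precompact

/-! ### Comparison of the classes -/

section General

theorem mem_RC_iff_kTopology_eq (X : TG.{u}) (hX : X ∈ MAP) :
    X ∈ RC ↔ kTopology X (bohrTopology X X.topologicalSpace) = kTopology X X.topologicalSpace := by
  refine ⟨fun h => kTopology_eq_of_isCompact_iff (le_bohrTopology _ _) hX h.2,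
    fun h => ⟨hX, fun K => ?_⟩⟩
  rw [← isCompact_kTopology_iff X.topologicalSpace inferInstance, ← h,
    isCompact_kTopology_iff _ (isTopologicalGroup_bohrTopology _)]

theorem mem_KGrp_inter_RC_iff_kTopology_eq (X : TG.{u}) (hX : X ∈ MAP) :
    X ∈ KGrp ∩ RC ↔ kTopology X (bohrTopology X X.topologicalSpace) = X.topologicalSpace := by
  refine ⟨fun h => ((mem_RC_iff_kTopology_eq X hX).1 h.2).trans h.1, fun h => ?_⟩
  have hRC : X ∈ RC := by
    refine ⟨hX, fun K => ?_⟩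
    conv_lhs => rw [← h]
    exact isCompact_kTopology_iff _ (isTopologicalGroup_bohrTopology _)
  exact ⟨((mem_RC_iff_kTopology_eq X hX).1 hRC).symm.trans h, hRC⟩

theorem continuous_of_continuous_bohrTopology (X : TG.{u}) (Y : TG.{v}) (hX : X ∈ KGrp)
    (hY : Y ∈ RC) (φ : X →* Y)
    (hφ : Continuous[bohrTopology X X.topologicalSpace, bohrTopology Y Y.topologicalSpace] φ) :
    Continuous φ := by
  refine IsKGroup.continuous_of_continuousOn hX φ fun K hK => ?_
  have hL : IsCompact (φ '' K) := (hY.2 _).2 <|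
    @IsCompact.image X Y (bohrTopology X X.topologicalSpace) (bohrTopology Y Y.topologicalSpace)
      K φ (isCompact_of_le (le_bohrTopology _ _) hK) hφ
  have hφ' : Continuous[X.topologicalSpace, bohrTopology Y Y.topologicalSpace] φ :=
    continuous_le_dom (le_bohrTopology _ _) hφ
  -- on the compact set `φ '' K` the topology of `Y` agrees with its Bohr topology
  have h1 : Continuous (Set.MapsTo.restrict φ K (φ '' K) (Set.mapsTo_image φ K)) := by
    refine continuous_iff_le_induced.2 ?_
    rw [show (instTopologicalSpaceSubtype : TopologicalSpace (φ '' K)) = _ from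
      induced_eq_induced_of_isCompact (le_bohrTopology Y Y.topologicalSpace) hY.1 hL,
      induced_compose, ← continuous_iff_le_induced]
    exact @Continuous.comp K X Y _ _ (bohrTopology Y Y.topologicalSpace) _ _ hφ'
      continuous_subtype_val
  exact continuousOn_iff_continuous_domRestrict.2 (continuous_subtype_val.comp h1)

theorem LCA_subset_KA_inter_RC : LCA.{u} ⊆ KA ∩ RC := by
  rintro X ⟨hX, hc⟩
  let _ : CommGroup X := { X.group with mul_comm := hc }
  exact ⟨⟨isKGroup_of_compactlyCoherentSpace, hc⟩, isMAP_of_locallyCompactSpace, fun K =>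
    ⟨isCompact_of_le (le_bohrTopology _ _), isCompact_of_isCompact_bohrTopology⟩⟩

end General

section Discrete

theorem not_isPrecompactGroup_of_discreteTopology (G : Type*) [Group G] [TopologicalSpace G]
    [DiscreteTopology G] [Infinite G] : ¬ IsPrecompactGroup G := by
  intro h
  obtain ⟨F, hF, h1, -⟩ := h {1} (by simp)
  refine Set.infinite_univ (hF.subset fun x _ => ?_)
  obtain ⟨a, ha, b, rfl, rfl⟩ := h1 x
  simpa using ha

/-- An infinite group has a non-discrete Bohr topology, since a discrete subgroup of a compact
group is closed and hence finite. -/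
theorem finite_of_bohrTopology_eq_bot (G : Type u) [Group G] [t : TopologicalSpace G]
    (h : bohrTopology G t = ⊥) : Finite G := by
  obtain ⟨B, _, _, i, hi⟩ := exists_isBohrCompactification G
  have := hi.isTopologicalGroup
  have := hi.compactSpace
  have := hi.t2Space
  have hd : DiscreteTopology G := ⟨bot_unique ((le_bohrTopology G t).trans h.le)⟩
  have hind : IsInducing i := ⟨by rw [← bohrTopology_eq_induced hi, h, hd.eq_bot]⟩
  have hrange : DiscreteTopology i.range := hind.isEmbedding.toHomeomorph.discreteTopology
  have hcl : IsClosed (i.range : Set B) := Subgroup.isClosed_of_discrete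
  have : CompactSpace i.range := isCompact_iff_compactSpace.1 hcl.isCompact
  have : Finite i.range := finite_of_compact_of_discrete
  exact Finite.of_injective i.rangeRestrict fun x y hxy =>
    hind.isEmbedding.injective (congrArg Subtype.val hxy)

/-- The additive group of integers with the discrete topology, in multiplicative notation. -/
def discreteInt : TG.{u} :=
  let t : TopologicalSpace (ULift.{u} (Multiplicative ℤ)) := ⊥
  have : DiscreteTopology (ULift.{u} (Multiplicative ℤ)) := ⟨rfl⟩
  { carrier := ULift.{u} (Multiplicative ℤ)
    topologicalSpace := t
    isTopologicalGroup := inferInstance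
    t2Space := inferInstance }

instance : DiscreteTopology discreteInt.{u} := ⟨rfl⟩

instance : Infinite discreteInt.{u} := inferInstanceAs (Infinite (ULift.{u} (Multiplicative ℤ)))

theorem discreteInt_mem_LCA : discreteInt.{u} ∈ LCA :=
  ⟨inferInstanceAs (LocallyCompactSpace discreteInt.{u}),
    fun x y => mul_comm (G := ULift.{u} (Multiplicative ℤ)) x y⟩

theorem discreteInt_notMem_PCom : discreteInt.{u} ∉ PCom :=
  not_isPrecompactGroup_of_discreteTopology discreteInt.{u}

/-- The group `X⁺`, that is, a MAP group with its Bohr topology. -/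
def BohrRespect.TG.bohr (X : TG.{u}) (hX : X ∈ MAP) : TG.{u} :=
  { carrier := X
    topologicalSpace := bohrTopology X X.topologicalSpace
    isTopologicalGroup := isTopologicalGroup_bohrTopology _
    t2Space := hX }

theorem bohr_mem_RC (X : TG.{u}) (hX : X ∈ MAP) : X.bohr hX ∈ RC :=
  mem_RC_of_bohrTopology_eq _ (bohrTopology_bohrTopology X.topologicalSpace)

/-- The `k`-modification of the Bohr topology on the integers is discrete because the integers
respect compactness, but the Bohr topology itself is not. -/
theorem bohr_discreteInt_notMem_KGrp :
    discreteInt.{u}.bohr (LCA_subset_KA_inter_RC discreteInt_mem_LCA).2.1 ∉ KGrp := by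
  intro h
  have hX := LCA_subset_KA_inter_RC discreteInt_mem_LCA.{u}
  have h1 := (mem_KGrp_inter_RC_iff_kTopology_eq discreteInt.{u} hX.2.1).1 ⟨hX.1.1, hX.2⟩
  have h2 : bohrTopology discreteInt.{u} discreteInt.{u}.topologicalSpace = ⊥ :=
    (h.symm.trans h1).trans rfl
  have := finite_of_bohrTopology_eq_bot _ h2
  exact not_finite discreteInt.{u}

end Discrete

section FiniteSupport

theorem circleExp_pi_ne_one : Circle.exp Real.pi ≠ 1 := by
  intro h
  have := congrArg (fun z : Circle => (z : ℂ)) h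
  simp only [Circle.coe_exp, Complex.exp_pi_mul_I, Circle.coe_one] at this
  norm_num at this

/-- The circle-valued sequences with finitely many terms different from `1`. -/
noncomputable def finiteSupportCircle : Subgroup (ULift.{u} ℕ → Circle) where
  carrier := {x | (Function.mulSupport x).Finite}
  one_mem' := by simp
  mul_mem' hx hy := (hx.union hy).subset (Function.mulSupport_mul _ _)
  inv_mem' hx := by simpa using hx

/-- The finitely supported circle-valued sequences with the topology of pointwise convergence. -/
noncomputable def finiteSupportTG : TG.{u} := { carrier := finiteSupportCircle.{u} }

theorem finiteSupportTG_mem_KA_inter_RC : finiteSupportTG.{u} ∈ KA ∩ RC := by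
  refine ⟨⟨?_, fun x y => mul_comm (G := finiteSupportCircle.{u}) x y⟩,
    mem_RC_of_bohrTopology_eq _ (bohrTopology_eq_self_of_induced finiteSupportCircle.subtype rfl)⟩
  exact isKGroup_of_compactlyCoherentSpace (G := finiteSupportCircle.{u})

theorem not_locallyCompactSpace_finiteSupportCircle :
    ¬ LocallyCompactSpace finiteSupportCircle.{u} := by
  intro _
  obtain ⟨N, hN, hN1⟩ := exists_compact_mem_nhds (1 : finiteSupportCircle.{u})
  have hK := (hN.image continuous_subtype_val).isClosed
  rw [nhds_subtype_eq_comap, mem_comap] at hN1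
  obtain ⟨V, hV, hVN⟩ := hN1
  rw [OneMemClass.coe_one, nhds_pi, Filter.mem_pi] at hV
  obtain ⟨I, hI, t, ht, hIt⟩ := hV
  -- `y` has infinite support but is a pointwise limit of the finitely supported `z J`
  classical
  let y : ULift.{u} ℕ → Circle := fun i => if i ∈ I then 1 else Circle.exp Real.pi
  let z : Finset (ULift.{u} ℕ) → ULift.{u} ℕ → Circle := fun J i => if i ∈ J then y i else 1
  have hz : ∀ J, z J ∈ Subtype.val '' N := by
    intro J
    have hzJ : z J ∈ finiteSupportCircle.{u} := by
      refine J.finite_toSet.subset fun i hi => ?_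
      by_contra h
      exact hi (if_neg h)
    refine ⟨⟨z J, hzJ⟩, hVN (hIt fun i hi => ?_), rfl⟩
    have : z J i = 1 := by simp [z, y, hi]
    change z J i ∈ t i
    rw [this]
    exact mem_of_mem_nhds (ht i)
  have hlim : Tendsto z atTop (𝓝 y) := by
    refine tendsto_pi_nhds.2 fun i => tendsto_const_nhds.congr' ?_
    filter_upwards [eventually_ge_atTop {i}] with J hJ
    simp [z, Finset.singleton_subset_iff.1 hJ]
  obtain ⟨⟨y', hy'⟩, -, hyy⟩ := hK.mem_of_tendsto hlim (Eventually.of_forall hz)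
  have hy : (Function.mulSupport y).Finite := by
    rw [← hyy]
    exact hy'
  refine Set.infinite_univ ((hI.union hy).subset fun i _ => ?_)
  by_cases hi : i ∈ I
  · exact Or.inl hi
  · refine Or.inr ?_
    simp [y, hi, circleExp_pi_ne_one]

end FiniteSupport

/-! ### A metrizable MAP group that does not respect compactness -/

/-- In an Abelian group, convergence to `1` in the Bohr topology is detected by characters, since
the characters of a compact Abelian group separate its points. -/
theorem tendsto_bohrTopology_one {G : Type u} [CommGroup G] [t : TopologicalSpace G]
    {ι : Type*} {l : Filter ι} {x : ι → G}
    (h : ∀ χ : G →* Circle, Continuous χ → Tendsto (fun i => χ (x i)) l (𝓝 1)) :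
    Tendsto x l (@nhds G (bohrTopology G t) 1) := by
  obtain ⟨B, _, _, i, hi⟩ := exists_isBohrCompactification G
  have := hi.isTopologicalGroup
  have := hi.compactSpace
  have := hi.t2Space
  have hc : ∀ a b : B, a * b = b * a := fun a b =>
    hi.denseRange.induction_on₂ (p := fun a b => a * b = b * a)
      (isClosed_eq (by fun_prop) (by fun_prop)) (fun a b => by
        rw [← map_mul, ← map_mul, mul_comm]) a b
  let _ : CommGroup B := { ‹Group B› with mul_comm := hc }
  rw [bohrTopology_eq_induced hi, nhds_induced, tendsto_comap_iff, map_one, tendsto_iff_ultrafilter]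
  intro 𝒰 h𝒰
  obtain ⟨b, -, hb⟩ := isCompact_univ.ultrafilter_le_nhds (𝒰.map (i ∘ x)) (by simp)
  have hb' : Tendsto (i ∘ x) 𝒰 (𝓝 b) := hb
  have hb1 : b = 1 := by
    by_contra hne
    obtain ⟨χ, hχ, hχb⟩ := exists_character_ne_one hne
    exact hχb (tendsto_nhds_unique ((hχ.tendsto b).comp hb')
      ((h (χ.comp i) (hχ.comp hi.continuous)).mono_left h𝒰))
  rwa [hb1] at hb'

section Uniform

/-- The group of all circle-valued sequences with the topology of uniform convergence. -/
noncomputable def uniformCircleTG : TG.{u} := { carrier := UniformFun (ULift.{u} ℕ) Circle }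

/-- In the uniform distance, changing many coordinates from `1` to `z` costs no more than changing
one. -/
theorem dist_mulSingle_le {ι : Type*} [DecidableEq ι] (T : Finset ι) (z : Circle) :
    dist (∏ n ∈ T, UniformFun.ofFun (Pi.mulSingle n z : ι → Circle)) 1 ≤ dist z 1 := by
  refine (UniformFun.dist_le dist_nonneg).2 fun i => ?_
  let ev : UniformFun ι Circle →* Circle :=
    { toFun := fun x => UniformFun.toFun x i
      map_one' := rfl
      map_mul' := fun _ _ => rfl }
  change dist (ev (∏ n ∈ T, UniformFun.ofFun (Pi.mulSingle n z : ι → Circle))) 1 ≤ _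
  rw [map_prod]
  change dist (∏ n ∈ T, (Pi.mulSingle n z : ι → Circle) i) 1 ≤ _
  rw [Finset.prod_pi_mulSingle]
  split_ifs
  · exact le_rfl
  · simp

theorem finite_setOf_pow_eq_one (n : ℕ) (hn : 0 < n) : {z : Circle | z ^ n = 1}.Finite := by
  refine Set.Finite.of_finite_image
    (((Polynomial.nthRoots n (1 : ℂ)).toFinset.finite_toSet).subset ?_) Circle.coe_injective.injOn
  rintro _ ⟨z, hz, rfl⟩
  have : ((z ^ n : Circle) : ℂ) = 1 := by rw [hz]; rfl
  simpa [Polynomial.mem_nthRoots hn] using this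

/-- A continuous character `χ` is trivial on all but finitely many of the sequences with a single
term `Circle.exp π = -1`. Let `ζ` be an `M`-th root of `-1` close to `1`, and `z n` the sequence
with `ζ` at `n`. If there were infinitely many exceptions, `χ (z n)` would take one of its finitely
many possible values `η`, with `η ^ M = -1`, at `M` of them; the product of these `z n` is close to
`1` and is sent to `-1`. -/
theorem finite_character_mulSingle_ne_one {ι : Type*} [DecidableEq ι]
    (χ : UniformFun ι Circle →* Circle) (hχ : Continuous χ) :
    {n | χ (UniformFun.ofFun (Pi.mulSingle n (Circle.exp Real.pi))) ≠ 1}.Finite := by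
  obtain ⟨δ, hδ, hδχ⟩ := Metric.continuousAt_iff.1 (hχ.continuousAt (x := 1)) 1 one_pos
  obtain ⟨ζ, M, hM, hζM, hζ⟩ : ∃ (ζ : Circle) (M : ℕ), 0 < M ∧ ζ ^ M = Circle.exp Real.pi ∧
      dist ζ 1 < δ := by
    have h1 : Tendsto (fun n : ℕ => Circle.exp (Real.pi / n)) atTop (𝓝 1) := by
      have := (Circle.exp.continuous.tendsto 0).comp
        (tendsto_const_div_atTop_nhds_zero_nat Real.pi)
      rwa [Circle.exp_zero] at this
    obtain ⟨n, hn, hn0⟩ :=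
      ((h1.eventually (Metric.ball_mem_nhds 1 hδ)).and (eventually_gt_atTop 0)).exists
    refine ⟨_, n, hn0, Circle.ext ?_, hn⟩
    have : (n : ℂ) ≠ 0 := by exact_mod_cast hn0.ne'
    rw [Circle.coe_pow, Circle.coe_exp, Circle.coe_exp, ← Complex.exp_nat_mul]
    congr 1
    push_cast
    field_simp
  let z : ι → UniformFun ι Circle := fun n => UniformFun.ofFun (Pi.mulSingle n ζ)
  have hz : ∀ n, UniformFun.ofFun (Pi.mulSingle n (Circle.exp Real.pi)) = z n ^ M := by
    intro n
    rw [← hζM]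
    exact Pi.mulSingle_pow (f := fun _ : ι => Circle) n ζ M
  have h2 : (Circle.exp Real.pi) ^ 2 = 1 := Circle.ext (by simp [Circle.coe_exp])
  have hroot : ∀ n, χ (z n) ^ (2 * M) = 1 := by
    intro n
    have : z n ^ (2 * M) = 1 := by
      rw [mul_comm, pow_mul, ← hz]
      refine (Pi.mulSingle_pow (f := fun _ : ι => Circle) n _ 2).symm.trans ?_
      rw [h2]
      exact Pi.mulSingle_one n
    rw [← map_pow, this, map_one]
  refine ((finite_setOf_pow_eq_one (2 * M) (by omega)).biUnion (t := fun η =>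
    {n | χ (z n) = η ∧ χ (z n) ^ M ≠ 1}) fun η _ => ?_).subset fun n hn => ?_
  · by_contra hinf
    obtain ⟨T, hT, hcard⟩ := Set.Infinite.exists_subset_card_eq hinf M
    have hprod : χ (∏ n ∈ T, z n) = η ^ M := by
      rw [map_prod, Finset.prod_congr rfl fun n hn => (hT hn).1, Finset.prod_const, hcard]
    have hd := hδχ ((dist_mulSingle_le T ζ).trans_lt hζ)
    rw [map_one] at hd
    change dist (χ (∏ n ∈ T, z n)) 1 < 1 at hd
    rw [hprod] at hd
    obtain ⟨n, hn⟩ : T.Nonempty := Finset.card_pos.1 (by omega)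
    have h3 : η ^ M ≠ 1 := by
      rw [← (hT hn).1]
      exact (hT hn).2
    have h4 : (η ^ M) ^ 2 = 1 := by
      rw [← pow_mul, mul_comm, ← (hT hn).1]
      exact hroot n
    have h5 : ((η ^ M : Circle) : ℂ) ^ 2 = 1 := by rw [← Circle.coe_pow, h4, Circle.coe_one]
    rcases sq_eq_one_iff.1 h5 with h6 | h6
    · exact h3 (Circle.ext h6)
    · have hd' : dist ((η ^ M : Circle) : ℂ) ((1 : Circle) : ℂ) < 1 := hd
      rw [h6, Circle.coe_one, Complex.dist_eq] at hd'
      norm_num at hd'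
  · refine Set.mem_biUnion (hroot n) ⟨rfl, ?_⟩
    rw [← map_pow, ← hz]
    exact hn

theorem uniformCircleTG_mem_KGrp : uniformCircleTG.{u} ∈ KGrp := by
  have : (uniformity (UniformFun (ULift.{u} ℕ) Circle)).IsCountablyGenerated :=
    EMetric.instIsCountablyGeneratedUniformity
  have h : IsKGroup (UniformFun (ULift.{u} ℕ) Circle) := isKGroup_of_compactlyCoherentSpace
  exact h

theorem uniformCircleTG_mem_MAP : uniformCircleTG.{u} ∈ MAP := by
  let X := UniformFun (ULift.{u} ℕ) Circle
  let t : TopologicalSpace X := inferInstance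
  have hev : ∀ n, Continuous[bohrTopology X t, _] fun x : X => UniformFun.toFun x n := fun n =>
    continuous_bohrTopology t
      { toFun := fun x : X => UniformFun.toFun x n
        map_one' := rfl
        map_mul' := fun _ _ => rfl } (UniformFun.uniformContinuous_eval _ n).continuous
  change @T2Space X (bohrTopology X t)
  let _ : TopologicalSpace X := bohrTopology X t
  refine ⟨fun x y hxy => ?_⟩
  obtain ⟨n, hn⟩ := Function.ne_iff.1 hxy
  exact separated_by_continuous (hev n) hn

theorem uniformCircleTG_notMem_RC : uniformCircleTG.{u} ∉ RC := by
  intro hRC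
  let X := UniformFun (ULift.{u} ℕ) Circle
  let t : TopologicalSpace X := inferInstance
  have hT2 : @T2Space X (bohrTopology X t) := hRC.1
  let x : ULift.{u} ℕ → X := fun n => UniformFun.ofFun (Pi.mulSingle n (Circle.exp Real.pi))
  have hx : Tendsto x cofinite (@nhds X (bohrTopology X t) 1) :=
    tendsto_bohrTopology_one fun χ hχ => tendsto_const_nhds.congr' <| by
      filter_upwards [(finite_character_mulSingle_ne_one χ hχ).compl_mem_cofinite] with n hn
      exact (not_not.1 hn).symm
  have hK : IsCompact (insert 1 (Set.range x)) :=
    (hRC.2 _).2 (@Tendsto.isCompact_insert_range_of_cofinite X _ (bohrTopology X t) x 1 hx)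
  let 𝒰 := hyperfilter (ULift.{u} ℕ)
  obtain ⟨y, -, hy⟩ := hK.ultrafilter_le_nhds (𝒰.map x) (by
    rw [le_principal_iff]
    exact Filter.mem_map.2 (univ_mem' fun n => Or.inr ⟨n, rfl⟩))
  have hy' : Tendsto x 𝒰 (𝓝 y) := hy
  -- a limit in the uniform topology is also the limit in the Bohr topology
  have hy1 : y = 1 := by
    have h1 : Tendsto x 𝒰 (@nhds X (bohrTopology X t) y) :=
      hy'.mono_right (nhds_mono (le_bohrTopology X t))
    exact @tendsto_nhds_unique X _ (bohrTopology X t) hT2 x _ y 1 _ h1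
      (hx.mono_left hyperfilter_le_cofinite)
  rw [hy1] at hy'
  have hpos : 0 < dist (Circle.exp Real.pi) 1 := dist_pos.2 circleExp_pi_ne_one
  obtain ⟨n, hn⟩ := (hy'.eventually (Metric.ball_mem_nhds 1 hpos)).exists
  have h1 := ((UniformFun.dist_le dist_nonneg).1 (le_refl (dist (x n) 1)) n).trans_lt hn
  change dist ((Pi.mulSingle n (Circle.exp Real.pi) : ULift.{u} ℕ → Circle) n) 1 < _ at h1
  rw [Pi.mulSingle_eq_same] at h1
  exact lt_irrefl _ h1

end Uniform

end

theorem propositionp61 :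
    (∀ X : TG.{u}, X ∈ MAP →
      (X ∈ RC ↔ kTopology X (bohrTopology X X.topologicalSpace) = kTopology X X.topologicalSpace)) ∧
    (∀ X : TG.{u}, X ∈ MAP →
      (X ∈ KGrp ∩ RC ↔ kTopology X (bohrTopology X X.topologicalSpace) = X.topologicalSpace)) ∧
    (PCom.{u} ⊂ RC ∧ LCA.{u} ⊂ KA ∩ RC) ∧
    (KGrp.{u} ∩ RC ⊂ KGrp ∧ KGrp.{u} ∩ RC ⊂ KGrp ∩ MAP ∧ KGrp.{u} ∩ RC ⊂ RC) ∧
    (∀ (X : TG.{u}) (Y : TG.{v}), X ∈ MAP → X ∈ KGrp → Y ∈ RC → ∀ φ : X →* Y,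
      Continuous[bohrTopology X X.topologicalSpace, bohrTopology Y Y.topologicalSpace] φ →
      Continuous φ) := by
  refine ⟨mem_RC_iff_kTopology_eq, mem_KGrp_inter_RC_iff_kTopology_eq, ⟨?_, ?_⟩, ⟨?_, ?_, ?_⟩,
    fun X Y _ hX hY φ hφ => continuous_of_continuous_bohrTopology X Y hX hY φ hφ⟩
  · exact ⟨PCom_subset_RC, fun h => discreteInt_notMem_PCom
      (h (LCA_subset_KA_inter_RC discreteInt_mem_LCA).2)⟩
  · exact ⟨LCA_subset_KA_inter_RC, fun h => not_locallyCompactSpace_finiteSupportCircle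
      (h finiteSupportTG_mem_KA_inter_RC).1⟩
  · exact ⟨Set.inter_subset_left, fun h => uniformCircleTG_notMem_RC
      (h uniformCircleTG_mem_KGrp).2⟩
  · exact ⟨fun X hX => ⟨hX.1, hX.2.1⟩, fun h => uniformCircleTG_notMem_RC
      (h ⟨uniformCircleTG_mem_KGrp, uniformCircleTG_mem_MAP⟩).2⟩
  · exact ⟨Set.inter_subset_right, fun h => bohr_discreteInt_notMem_KGrp
      (h (bohr_mem_RC _ _)).1⟩
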